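/- Let $d\in\mathbb N\cup\{\infty\}$ and let $\mathbb F^d$ be the free monoid of words in $d$ letters. Let $H^2=H^2(\mathbb B^d_{\mathbb N})$ be the NC Hardy space (full Fock space) of power series $f=\sum_{\alpha\in\mathbb F^d}\hat f_\alpha\mathfrak z^\alpha$ in $d$ non-commuting variables with $\sum_\alpha|\hat f_\alpha|^2<\infty$. For Hilbert spaces $\mathcal H,\mathcal J$, let $H^\infty\otimes\mathcal L(\mathcal H,\mathcal J)$ denote the left multipliers: power series $M=\sum_\alpha M_\alpha\mathfrak z^\alpha$ with coefficients $M_\alpha\in\mathcal L(\mathcal H,\mathcal J)$ for which left multiplication $M(L):f\mapsto Mf$ is a bounded operator $H^2\otimes\mathcal H\to H^2\otimes\mathcal J$. Such an $M$ is *inner* if $M(L)$ is an isometry; $H^\infty$ is the case $\mathcal H=\mathcal J=\mathbb C$. Put $\mathbb C^\infty=\ell^2(\mathbb N)$. For $n\in\{1,2,\dots\}\cup\{\infty\}$ let $\mathbb B^d_n$ be the set of strict row contractions on $\mathbb C^n$, i.e. tuples $Z=(Z_1,\dots,Z_d)$ of bounded operators on $\mathbb C^n$ such that $\sum_jZ_jZ_j^*\le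 r^2I$ for some $r<1$. The left singularity locus of $M$ is $$\mathrm{Sing}(M)=\bigsqcup_{n\in\{1,2,\dots\}\cup\{\infty\}}\{(Z,y)\in\mathbb B^d_n\times\mathbb C^n:\ y^*M(Z)\equiv0\},$$ where $y^*M(Z)\equiv 0$ means $\langle y\otimes g,M(Z)(x\otimes h)\rangle=0$ for all $x\in\mathbb C^n$, $h\in\mathcal H$, $g\in\mathcal J$. The singularity space of $M$ is $$\mathscr S(M)=\{f\in H^2\otimes\mathcal J:\ y^*f(Z)\equiv0\text{ for all }(Z,y)\in\mathrm{Sing}(M)\}.$$ An inner $M$ is *Blaschke* if $\mathrm{ran}\,M(L)=\mathscr S(M)$. **Proposition.** Let $\Theta\in H^\infty$ be inner. Then there are $N\in\mathbb N\cup\{\infty\}$, a row $B=(B_1,\dots,B_N)\in H^\infty\otimes\mathcal L(\mathbb C^N,\mathbb C)$ and a column $S=(S_1,\dots,S_N)^T\in H^\infty\otimes\mathcal L(\mathbb C,\mathbb C^N)$ such that $$\Theta(L)=B(L)S(L),\qquad \Theta(L)f=\sum_{k=1}^NB_k(L)S_k(L)f\quad(f\in H^2),$$ $\mathrm{ran}\,B(L)=\mathscr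 S(\Theta)$, $\mathrm{Sing}(\Theta)=\mathrm{Sing}(B)$, $B$ is NC Blaschke inner, every component $B_k$ is inner, the ranges of the $B_k(L)$ are pairwise orthogonal, and the column $S$ is inner. -/

import Mathlib

open scoped lp InnerProductSpace

noncomputable section

namespace NCHardy

/-- The index set `{0, …, N - 1}` if `N` is finite, and `ℕ` if `N = ∞`. -/
abbrev Idx (N : ℕ∞) : Type := {k : ℕ // (k : ℕ∞) < N}

/-- The Hilbert space `ℂ ^ N` for `N ∈ ℕ ∪ {∞}`, with `ℂ ^ ∞ = ℓ²(ℕ)`. -/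
abbrev Cn (N : ℕ∞) : Type := lp (fun _ : Idx N => ℂ) 2

/-- The Hilbert space `H² ⊗ H` of power series in the non-commuting variables `𝔷 j`, `j : ι`, with
square-summable coefficients in `H`: the full Fock space over `ℓ²(ι)`, tensored with `H`.
The word `α = i₁ ⋯ iₙ` is an element of the free monoid on `ι`. -/
abbrev H2 (ι : Type*) (H : Type*) [NormedAddCommGroup H] : Type _ :=
  lp (fun _ : FreeMonoid ι => H) 2

section Evaluation

variable {ι : Type*} {E : Type*} [NormedAddCommGroup E] [InnerProductSpace ℂ E] [CompleteSpace E]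

/-- `Z = (Z j)` is a strict row contraction: `∑ j, Z j (Z j)^* ≤ r² I` for some `r < 1`, that is,
the row `Z : E ⊗ ℓ²(ι) → E` has norm less than `1`. -/
def IsStrictRowContraction (Z : ι → E →L[ℂ] E) : Prop :=
  ∃ r : ℝ, 0 ≤ r ∧ r < 1 ∧ ∀ (y : E) (s : Finset ι),
    ∑ j ∈ s, ‖ContinuousLinearMap.adjoint (Z j) y‖ ^ 2 ≤ r ^ 2 * ‖y‖ ^ 2

/-- The monomial `Z^α = Z_{i₁} ⋯ Z_{iₙ}` for the word `α = i₁ ⋯ iₙ`. -/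
def mon (Z : ι → E →L[ℂ] E) (α : FreeMonoid ι) : E →L[ℂ] E :=
  FreeMonoid.lift Z α

/-- The value `f(Z) = ∑ α, f α • Z^α` of a scalar power series; for square-summable
coefficients and strict row contractions the series converges in operator norm, see `summable_eval`. -/
def eval (f : FreeMonoid ι → ℂ) (Z : ι → E →L[ℂ] E) : E →L[ℂ] E :=
  ∑' α : FreeMonoid ι, f α • mon Z α

theorem sum_norm_adjoint_mon_le {Z : ι → E →L[ℂ] E} {r : ℝ} (hr0 : 0 ≤ r) (hr1 : r < 1)
    (hZ : ∀ (y : E) (s : Finset ι),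
      ∑ j ∈ s, ‖ContinuousLinearMap.adjoint (Z j) y‖ ^ 2 ≤ r ^ 2 * ‖y‖ ^ 2)
    (n : ℕ) (s : Finset (FreeMonoid ι)) (hs : ∀ α ∈ s, α.length < n) (y : E) :
    ∑ α ∈ s, ‖ContinuousLinearMap.adjoint (mon Z α) y‖ ^ 2 ≤ (1 - r ^ 2)⁻¹ * ‖y‖ ^ 2 := by
  classical
  have h1 : 0 < 1 - r ^ 2 := by nlinarith
  have hc : 0 ≤ (1 - r ^ 2)⁻¹ := by positivity
  have hc' : 1 + (1 - r ^ 2)⁻¹ * r ^ 2 = (1 - r ^ 2)⁻¹ := by field_simp; ring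
  induction n generalizing s y with
  | zero =>
    have : s = ∅ := Finset.eq_empty_of_forall_notMem fun α hα => by simpa using hs α hα
    subst this
    simp only [Finset.sum_empty]
    positivity
  | succ n ih =>
    let J : Finset ι := s.biUnion fun α => (FreeMonoid.toList α).toFinset
    let G : Finset (FreeMonoid ι) := (s.filter fun α => α ≠ 1).image
      fun α => FreeMonoid.ofList (FreeMonoid.toList α).tail
    have hG : ∀ β ∈ G, β.length < n := by
      intro β hβ
      obtain ⟨α, hα, rfl⟩ := Finset.mem_image.1 hβ
      obtain ⟨hαs, hα1⟩ := Finset.mem_filter.1 hα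
      have h := hs α hαs
      have h0 : α.length ≠ 0 := fun h0 => hα1 (FreeMonoid.length_eq_zero.1 h0)
      simp only [FreeMonoid.length, FreeMonoid.toList_ofList, List.length_tail] at h h0 ⊢
      omega
    have hsub : s ⊆ insert 1 ((J ×ˢ G).image fun p => FreeMonoid.of p.1 * p.2) := by
      intro α hα
      rcases eq_or_ne α 1 with h | h
      · exact Finset.mem_insert.2 (Or.inl h)
      · refine Finset.mem_insert_of_mem (Finset.mem_image.2 ?_)
        cases α using FreeMonoid.casesOn with
        | one => exact absurd rfl h
        | of_mul x xs =>
          refine ⟨(x, xs), Finset.mem_product.2 ⟨?_, ?_⟩, rfl⟩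
          · exact Finset.mem_biUnion.2 ⟨_, hα, by simp⟩
          · exact Finset.mem_image.2 ⟨_, Finset.mem_filter.2 ⟨hα, h⟩, rfl⟩
    calc ∑ α ∈ s, ‖ContinuousLinearMap.adjoint (mon Z α) y‖ ^ 2
        ≤ ∑ α ∈ insert 1 ((J ×ˢ G).image fun p => FreeMonoid.of p.1 * p.2),
            ‖ContinuousLinearMap.adjoint (mon Z α) y‖ ^ 2 :=
          Finset.sum_le_sum_of_subset_of_nonneg hsub fun _ _ _ => by positivity
      _ = ‖y‖ ^ 2 + ∑ p ∈ J ×ˢ G,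
            ‖ContinuousLinearMap.adjoint (mon Z (FreeMonoid.of p.1 * p.2)) y‖ ^ 2 := by
          rw [Finset.sum_insert, Finset.sum_image]
          · congr 2
            have : mon Z 1 = ContinuousLinearMap.id ℂ E := by
              simp only [mon, map_one]; rfl
            rw [this, ContinuousLinearMap.adjoint_id]; rfl
          · rintro ⟨a, b⟩ - ⟨c, d⟩ - h
            have h' := congrArg FreeMonoid.toList h
            simp only [FreeMonoid.toList_of_mul, List.cons.injEq] at h'
            exact Prod.ext h'.1 (FreeMonoid.toList.injective h'.2)
          · intro h
            obtain ⟨p, -, hp⟩ := Finset.mem_image.1 h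
            have := congrArg FreeMonoid.length hp
            simp [FreeMonoid.length_mul, FreeMonoid.length_of] at this
      _ = ‖y‖ ^ 2 + ∑ j ∈ J, ∑ β ∈ G,
            ‖ContinuousLinearMap.adjoint (mon Z β) (ContinuousLinearMap.adjoint (Z j) y)‖ ^ 2 := by
          rw [Finset.sum_product]
          congr 1
          refine Finset.sum_congr rfl fun j _ => Finset.sum_congr rfl fun β _ => ?_
          have : mon Z (FreeMonoid.of j * β) = Z j ∘L mon Z β := by
            simp only [mon, map_mul, FreeMonoid.lift_eval_of]; rfl
          rw [this, ContinuousLinearMap.adjoint_comp]; rfl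
      _ ≤ ‖y‖ ^ 2 + ∑ j ∈ J, (1 - r ^ 2)⁻¹ * ‖ContinuousLinearMap.adjoint (Z j) y‖ ^ 2 := by
          gcongr with j _
          exact ih G hG _
      _ ≤ ‖y‖ ^ 2 + (1 - r ^ 2)⁻¹ * (r ^ 2 * ‖y‖ ^ 2) := by
          rw [← Finset.mul_sum]
          gcongr
          exact hZ y J
      _ = (1 - r ^ 2)⁻¹ * ‖y‖ ^ 2 := by
          rw [← mul_assoc, ← one_add_mul, hc']

/-- The series that defines `eval` converges in operator norm. -/
theorem summable_eval (f : H2 ι ℂ) {Z : ι → E →L[ℂ] E} (hZ : IsStrictRowContraction Z) :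
    Summable fun α : FreeMonoid ι => (f α) • mon Z α := by
  obtain ⟨r, hr0, hr1, hr⟩ := hZ
  have h1 : 0 < 1 - r ^ 2 := by nlinarith
  set c := (1 - r ^ 2)⁻¹ with hc
  have hc0 : 0 < c := by positivity
  have hbd : ∀ s : Finset (FreeMonoid ι), ‖∑ α ∈ s, (f α) • mon Z α‖ ≤
      √c * √(∑ α ∈ s, ‖f α‖ ^ 2) := by
    intro s
    have hs : ∀ y : E, ∑ α ∈ s, ‖ContinuousLinearMap.adjoint (mon Z α) y‖ ^ 2 ≤ c * ‖y‖ ^ 2 :=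
      sum_norm_adjoint_mon_le hr0 hr1 hr (s.sup FreeMonoid.length + 1) s
        (fun α hα => Nat.lt_succ_of_le (Finset.le_sup (f := FreeMonoid.length) hα))
    rw [← ContinuousLinearMap.adjoint.norm_map]
    refine ContinuousLinearMap.opNorm_le_bound _ (by positivity) fun y => ?_
    calc ‖ContinuousLinearMap.adjoint (∑ α ∈ s, (f α) • mon Z α) y‖
        ≤ ∑ α ∈ s, ‖f α‖ * ‖ContinuousLinearMap.adjoint (mon Z α) y‖ := by
          rw [map_sum, sum_apply]
          refine (norm_sum_le _ _).trans (Finset.sum_le_sum fun α _ => ?_)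
          rw [map_smulₛₗ, smul_apply, norm_smul]
          simp
      _ ≤ √(∑ α ∈ s, ‖f α‖ ^ 2) *
            √(∑ α ∈ s, ‖ContinuousLinearMap.adjoint (mon Z α) y‖ ^ 2) :=
          Real.sum_mul_le_sqrt_mul_sqrt _ _ _
      _ ≤ √(∑ α ∈ s, ‖f α‖ ^ 2) * √(c * ‖y‖ ^ 2) := by
          gcongr
          exact hs y
      _ = √c * √(∑ α ∈ s, ‖f α‖ ^ 2) * ‖y‖ := by
          rw [Real.sqrt_mul hc0.le, Real.sqrt_sq (norm_nonneg y)]; ring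
  have hf : Summable fun α => ‖f α‖ ^ 2 := by
    have := (lp.memℓp f).summable (by norm_num)
    simpa using this
  rw [summable_iff_vanishing_norm]
  intro ε hε
  obtain ⟨s, hs⟩ := summable_iff_vanishing_norm.1 hf (ε ^ 2 / c) (by positivity)
  refine ⟨s, fun t ht => (hbd t).trans_lt ?_⟩
  have h2 := (le_abs_self _).trans_lt (hs t ht)
  rw [← Real.sqrt_mul hc0.le, Real.sqrt_lt' hε]
  rwa [lt_div_iff₀ hc0, mul_comm] at h2

end Evaluation

section Multipliers

variable (ι : Type*) (H J : Type*) [NormedAddCommGroup H] [InnerProductSpace ℂ H]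
  [NormedAddCommGroup J] [InnerProductSpace ℂ J]

/-- The left multipliers `H^∞ ⊗ 𝓛(H, J)`: power series `∑ α, symbol α 𝔷^α` with coefficients in
`𝓛(H, J)` for which left multiplication (Cauchy product of series, the sum running over all
factorizations `γ = α β` of a word) is a bounded operator `op` from `H² ⊗ H` to `H² ⊗ J`. -/
structure LeftMultiplier where
  symbol : FreeMonoid ι → (H →L[ℂ] J)
  op : H2 ι H →L[ℂ] H2 ι J
  op_apply : ∀ (f : H2 ι H) (γ : FreeMonoid ι),
    op f γ = ∑ k ∈ Finset.range (γ.length + 1),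
      symbol (FreeMonoid.ofList (γ.toList.take k)) (f (FreeMonoid.ofList (γ.toList.drop k)))

variable {ι H J}

namespace LeftMultiplier

/-- The multiplier `(I ⊗ A) M (I ⊗ C)`, for constant operators `A` and `C`. -/
def constMul {H' J' : Type*} [NormedAddCommGroup H'] [InnerProductSpace ℂ H']
    [NormedAddCommGroup J'] [InnerProductSpace ℂ J']
    (A : J →L[ℂ] J') (M : LeftMultiplier ι H J) (C : H' →L[ℂ] H) : LeftMultiplier ι H' J' where
  symbol α := A ∘L M.symbol α ∘L C
  op := lp.mapCLM 2 (fun _ => A) (norm_nonneg A) (fun _ => le_rfl) ∘L M.op ∘L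
    lp.mapCLM 2 (fun _ => C) (norm_nonneg C) (fun _ => le_rfl)
  op_apply f γ := by
    change A (M.op _ γ) = _
    rw [M.op_apply, map_sum]
    rfl

/-- The `k`-th entry `B_k` of a row `B = (B_0, B_1, …)`: `B_k(L) f = B(L) (f ⊗ e_k)`. -/
def rowEntry {N : ℕ∞} (B : LeftMultiplier ι (Cn N) ℂ) (k : Idx N) : LeftMultiplier ι ℂ ℂ :=
  constMul (.id ℂ ℂ) B (lp.singleContinuousLinearMap ℂ (fun _ : Idx N => ℂ) 2 k)

/-- The `k`-th entry `S_k` of a column `S`: `S_k(L) f` is the `k`-th component of `S(L) f`. -/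
def colEntry {N : ℕ∞} (S : LeftMultiplier ι ℂ (Cn N)) (k : Idx N) : LeftMultiplier ι ℂ ℂ :=
  constMul (lp.evalCLM ℂ (fun _ : Idx N => ℂ) 2 k) S (.id ℂ ℂ)

/-- A left multiplier is inner if it is an isometry. -/
def IsInner (M : LeftMultiplier ι H J) : Prop :=
  Isometry M.op

/-- `y^* M(Z) ≡ 0`, that is `⟪y ⊗ g, M(Z) (x ⊗ h)⟫ = 0` for all `x`, `h` and `g`, where
`⟪y ⊗ g, M(Z) (x ⊗ h)⟫ = ∑ α, ⟪g, symbol α h⟫ ⟪y, Z^α x⟫`. -/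
def LeftZeroAt {n : ℕ∞} (M : LeftMultiplier ι H J) (Z : ι → Cn n →L[ℂ] Cn n) (y : Cn n) : Prop :=
  ∀ (x : Cn n) (h : H) (g : J), ⟪y, eval (fun α => ⟪g, M.symbol α h⟫_ℂ) Z x⟫_ℂ = 0

/-- The left singularity locus `Sing M`, graded by the level `n ∈ {1, 2, …} ∪ {∞}`: all pairs
`(Z, y)` of a strict row contraction `Z` on `ℂ ^ n` and `y ∈ ℂ ^ n` with `y^* M(Z) ≡ 0`. -/
def sing (M : LeftMultiplier ι H J) : Set (Σ n : ℕ∞, (ι → Cn n →L[ℂ] Cn n) × Cn n) :=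
  {p | 1 ≤ p.1 ∧ IsStrictRowContraction p.2.1 ∧ M.LeftZeroAt p.2.1 p.2.2}

/-- The singularity space of `M`: all `f ∈ H² ⊗ J` with `y^* f(Z) ≡ 0` for all `(Z, y) ∈ Sing M`,
where `⟪y ⊗ g, f(Z) x⟫ = ∑ α, ⟪g, f α⟫ ⟪y, Z^α x⟫`. -/
def singSpace (M : LeftMultiplier ι H J) : Set (H2 ι J) :=
  {f | ∀ p ∈ M.sing, ∀ (x : Cn p.1) (g : J), ⟪p.2.2, eval (fun α => ⟪g, f α⟫_ℂ) p.2.1 x⟫_ℂ = 0}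

/-- An inner left multiplier is Blaschke if its range is its singularity space. -/
def IsBlaschke (M : LeftMultiplier ι H J) : Prop :=
  M.IsInner ∧ Set.range M.op = M.singSpace

end LeftMultiplier

end Multipliers

end NCHardy

end

/-! The condition y^* f(Z) ≡ 0 is closed in f, because point evaluations at strict row contractions
are bounded (`exists_inner_eval_eq`). It survives right multiplication by words, because (f 𝔷^β)(Z)
= f(Z) Z^β (`inner_eval_rightMul`). So 𝒮(Θ) is a closed right-invariant subspace, and Beurling's
theorem (`exists_isInner_range_eq`) makes it the range of an inner row B. This rests on the Wold
decomposition: the right shifts are isometries with orthogonal ranges, and repeatedly stripping last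
letters leaves nothing outside the shifts of the wandering subspace.

Since ran Θ(L) ⊆ 𝒮(Θ) = ran B(L), the operator S = B(L)^* Θ(L) satisfies Θ = BS. It is isometric and
commutes with right multiplication, hence is an inner column (`IsInner.exists_eq_comp`). From ran
B(L) = 𝒮(Θ) follows Sing Θ = Sing B (`sing_eq_of_range_eq`), so 𝒮(B) = 𝒮(Θ) and B is Blaschke. -/

noncomputable section

namespace NCHardy

/-! ### Right shifts on the Fock space -/

section Shift

variable {ι : Type*} {H : Type*} [NormedAddCommGroup H] [InnerProductSpace ℂ H]

/-- The embedding `h ↦ h 𝔷^α` of the coefficient space. -/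
def monomial (α : FreeMonoid ι) : H →ₗᵢ[ℂ] H2 ι H :=
  letI := Classical.decEq (FreeMonoid ι)
  { toLinearMap := (lp.singleContinuousLinearMap ℂ (fun _ : FreeMonoid ι => H) 2 α).toLinearMap
    norm_map' := fun h => lp.norm_single (E := fun _ : FreeMonoid ι => H) (by norm_num) α h }

theorem monomial_apply_self (α : FreeMonoid ι) (h : H) : monomial α h α = h := by
  let := Classical.decEq (FreeMonoid ι)
  exact lp.single_apply_self (E := fun _ : FreeMonoid ι => H) 2 α h

theorem monomial_apply_of_ne {α γ : FreeMonoid ι} (hγ : γ ≠ α) (h : H) : monomial α h γ = 0 := by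
  let := Classical.decEq (FreeMonoid ι)
  exact lp.single_apply_ne (E := fun _ : FreeMonoid ι => H) 2 α h hγ

theorem inner_monomial_left (α : FreeMonoid ι) (h : H) (f : H2 ι H) :
    ⟪monomial α h, f⟫_ℂ = ⟪h, f α⟫_ℂ := by
  let := Classical.decEq (FreeMonoid ι)
  exact lp.inner_single_left (G := fun _ : FreeMonoid ι => H) α h f

theorem ext_monomial {F : Type*} [AddCommMonoid F] [Module ℂ F] [TopologicalSpace F] [T2Space F]
    {A B : H2 ι H →L[ℂ] F} (h : ∀ α x, A (monomial α x) = B (monomial α x)) : A = B := by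
  let := Classical.decEq (FreeMonoid ι)
  exact lp.ext_continuousLinearMap (E := fun _ : FreeMonoid ι => H) (by norm_num) fun α =>
    ContinuousLinearMap.ext fun x => h α x

theorem orthogonalFamily_monomial_mul (β : FreeMonoid ι) :
    OrthogonalFamily ℂ (fun _ : FreeMonoid ι => H) fun α => monomial (α * β) := by
  intro α γ hne x y
  rw [inner_monomial_left, monomial_apply_of_ne, inner_zero_right]
  exact fun h => hne (mul_right_cancel h)

variable [CompleteSpace H]

/-- Right multiplication by the word `β`. -/
def rightMul (β : FreeMonoid ι) : H2 ι H →ₗᵢ[ℂ] H2 ι H :=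
  (orthogonalFamily_monomial_mul β).linearIsometry

theorem rightMul_monomial (β α : FreeMonoid ι) (h : H) :
    rightMul β (monomial α h) = monomial (α * β) h := by
  let := Classical.decEq (FreeMonoid ι)
  exact (orthogonalFamily_monomial_mul β).linearIsometry_apply_single h

theorem rightMul_one (f : H2 ι H) : rightMul 1 f = f := by
  have : (rightMul 1 : H2 ι H →ₗᵢ[ℂ] H2 ι H).toContinuousLinearMap = .id ℂ _ :=
    ext_monomial fun α x => by simp [rightMul_monomial]
  exact DFunLike.congr_fun this f

theorem rightMul_rightMul (α β : FreeMonoid ι) (f : H2 ι H) :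
    rightMul α (rightMul β f) = rightMul (β * α) f := by
  have : (rightMul α : H2 ι H →ₗᵢ[ℂ] H2 ι H).toContinuousLinearMap ∘L
      (rightMul β).toContinuousLinearMap = (rightMul (β * α)).toContinuousLinearMap :=
    ext_monomial fun γ x => by simp [rightMul_monomial, mul_assoc]
  exact DFunLike.congr_fun this f

theorem rightMul_apply_mul (β γ : FreeMonoid ι) (f : H2 ι H) :
    rightMul β f (γ * β) = f γ := by
  refine ext_inner_left ℂ fun h => ?_
  rw [← inner_monomial_left, ← rightMul_monomial, LinearIsometry.inner_map_map,
    inner_monomial_left]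

theorem rightMul_apply_of_notMem {β γ : FreeMonoid ι} (hγ : γ ∉ Set.range (· * β)) (f : H2 ι H) :
    rightMul β f γ = 0 := by
  have : lp.evalCLM ℂ (fun _ : FreeMonoid ι => H) 2 γ ∘L (rightMul β).toContinuousLinearMap = 0 :=
    ext_monomial fun α x => by
      have := monomial_apply_of_ne (fun h => hγ ⟨α, h.symm⟩) x
      simpa [rightMul_monomial, lp.evalCLM] using this
  exact DFunLike.congr_fun this f

/-- A word has at most one last letter, so the two series have disjoint supports. -/
theorem inner_rightMul_of_ne {i j : ι} (hij : i ≠ j) (f g : H2 ι H) :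
    ⟪rightMul (.of i) f, rightMul (.of j) g⟫_ℂ = 0 := by
  rw [lp.inner_eq_tsum]
  refine (tsum_congr fun γ => ?_).trans tsum_zero
  by_cases hi : γ ∈ Set.range (· * FreeMonoid.of i)
  · have hj : γ ∉ Set.range (· * FreeMonoid.of j) := by
      rintro ⟨β, rfl⟩
      obtain ⟨α, hα⟩ := hi
      have := congrArg (fun γ => γ.toList.getLast?) hα
      simp [FreeMonoid.toList_mul] at this
      exact hij this
    rw [rightMul_apply_of_notMem hj, inner_zero_right]
  · rw [rightMul_apply_of_notMem hi, inner_zero_left]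

theorem adjoint_rightMul_apply (i : ι) (f : H2 ι H) (α : FreeMonoid ι) :
    ContinuousLinearMap.adjoint (rightMul (.of i)).toContinuousLinearMap f α =
      f (α * .of i) := by
  refine ext_inner_left ℂ fun h => ?_
  rw [← inner_monomial_left, ContinuousLinearMap.adjoint_inner_right,
    LinearIsometry.coe_toContinuousLinearMap, rightMul_monomial, inner_monomial_left]

theorem reverseInduction {p : FreeMonoid ι → Prop} (one : p 1)
    (mul_of : ∀ α i, p α → p (α * .of i)) (α : FreeMonoid ι) : p α :=
  List.reverseRecOn (motive := p) α one fun α i h => mul_of α i h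

end Shift

/-! ### Left multipliers as operators commuting with right shifts -/

section Multiplication

variable {ι : Type*} {H J : Type*} [NormedAddCommGroup H] [InnerProductSpace ℂ H]
  [NormedAddCommGroup J] [InnerProductSpace ℂ J]

/-- Only the cut of δβ right after δ contributes: every other suffix has a length different from
that of β. -/
theorem cauchyProduct_monomial_mul (M : FreeMonoid ι → H →L[ℂ] J) (β δ : FreeMonoid ι) (h : H) :
    ∑ k ∈ Finset.range ((δ * β).length + 1), M (.ofList ((δ * β).toList.take k))
      (monomial β h (FreeMonoid.ofList ((δ * β).toList.drop k))) = M δ h := by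
  rw [Finset.sum_eq_single δ.length]
  · have h1 : FreeMonoid.ofList ((δ * β).toList.take δ.length) = δ :=
      List.take_left (l₁ := δ.toList)
    have h2 : FreeMonoid.ofList ((δ * β).toList.drop δ.length) = β :=
      List.drop_left (l₁ := δ.toList)
    rw [h1, h2, monomial_apply_self]
  · intro k hk hne
    rw [monomial_apply_of_ne, map_zero]
    intro heq
    have := congrArg FreeMonoid.length heq
    rw [Finset.mem_range] at hk
    simp only [FreeMonoid.length, FreeMonoid.toList_ofList, List.length_drop,
      FreeMonoid.toList_mul, List.length_append] at this hk hne
    omega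
  · intro hk
    simp [FreeMonoid.length_mul] at hk

theorem cauchyProduct_monomial_of_notMem (M : FreeMonoid ι → H →L[ℂ] J) {β γ : FreeMonoid ι}
    (hγ : γ ∉ Set.range (· * β)) (h : H) :
    ∑ k ∈ Finset.range (γ.length + 1), M (.ofList (γ.toList.take k))
      (monomial β h (FreeMonoid.ofList (γ.toList.drop k))) = 0 := by
  refine Finset.sum_eq_zero fun k _ => ?_
  rw [monomial_apply_of_ne, map_zero]
  intro heq
  refine hγ ⟨.ofList (γ.toList.take k), ?_⟩
  simp only [← heq]
  exact List.take_append_drop k γ.toList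

namespace LeftMultiplier

theorem op_monomial_one (M : LeftMultiplier ι H J) (h : H) (α : FreeMonoid ι) :
    M.op (monomial 1 h) α = M.symbol α h := by
  rw [M.op_apply]
  simpa using cauchyProduct_monomial_mul M.symbol 1 α h

variable [CompleteSpace J]

theorem op_monomial (M : LeftMultiplier ι H J) (β : FreeMonoid ι) (h : H) :
    M.op (monomial β h) = rightMul β (M.op (monomial 1 h)) := by
  ext γ
  by_cases hγ : γ ∈ Set.range (· * β)
  · obtain ⟨δ, rfl⟩ := hγ
    rw [rightMul_apply_mul, op_monomial_one, M.op_apply, cauchyProduct_monomial_mul]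
  · rw [rightMul_apply_of_notMem hγ, M.op_apply, cauchyProduct_monomial_of_notMem _ hγ]

theorem op_rightMul [CompleteSpace H] (M : LeftMultiplier ι H J) (β : FreeMonoid ι) (f : H2 ι H) :
    M.op (rightMul β f) = rightMul β (M.op f) := by
  have : M.op ∘L (rightMul β).toContinuousLinearMap =
      (rightMul β).toContinuousLinearMap ∘L M.op :=
    ext_monomial fun α x => by
      simp [rightMul_monomial, op_monomial M (α * β), op_monomial M α, rightMul_rightMul]
  exact DFunLike.congr_fun this f

/-- A bounded operator that commutes with right multiplication is a left multiplier. -/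
def ofCommute (T : H2 ι H →L[ℂ] H2 ι J)
    (hT : ∀ β h, T (monomial β h) = rightMul β (T (monomial 1 h))) : LeftMultiplier ι H J where
  symbol α := lp.evalCLM ℂ (fun _ : FreeMonoid ι => J) 2 α ∘L T ∘L
    (monomial 1).toContinuousLinearMap
  op := T
  op_apply f γ := by
    set M : FreeMonoid ι → H →L[ℂ] J := fun α => lp.evalCLM ℂ (fun _ : FreeMonoid ι => J) 2 α ∘L
      T ∘L (monomial 1).toContinuousLinearMap
    have : lp.evalCLM ℂ (fun _ : FreeMonoid ι => J) 2 γ ∘L T =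
        ∑ k ∈ Finset.range (γ.length + 1), M (.ofList (γ.toList.take k)) ∘L
          lp.evalCLM ℂ (fun _ : FreeMonoid ι => H) 2 (.ofList (γ.toList.drop k)) := by
      -- Both sides are bounded in f, so the Cauchy product need only be checked on monomials.
      refine ext_monomial fun β h => ?_
      rw [sum_apply]
      change T (monomial β h) γ = ∑ k ∈ Finset.range (γ.length + 1),
        M (.ofList (γ.toList.take k)) (monomial β h (FreeMonoid.ofList (γ.toList.drop k)))
      rw [hT]
      by_cases hγ : γ ∈ Set.range (· * β)
      · obtain ⟨δ, rfl⟩ := hγ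
        rw [rightMul_apply_mul, cauchyProduct_monomial_mul]
        rfl
      · rw [rightMul_apply_of_notMem hγ, cauchyProduct_monomial_of_notMem _ hγ]
    have := DFunLike.congr_fun this f
    rw [sum_apply] at this
    exact this

end LeftMultiplier

end Multiplication

theorem hasSum_norm_sq {κ : Type*} {G : κ → Type*} [∀ i, NormedAddCommGroup (G i)] (f : lp G 2) :
    HasSum (fun i => ‖f i‖ ^ 2) (‖f‖ ^ 2) := by
  simpa using lp.hasSum_norm (by norm_num) f

theorem memℓp_two_of_sum_le {κ : Type*} {f : κ → ℂ} {C : ℝ}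
    (h : ∀ s : Finset κ, ∑ i ∈ s, ‖f i‖ ^ 2 ≤ C) : Memℓp f 2 :=
  memℓp_gen' (C := C) fun s => by simpa using h s

/-! ### Point evaluations -/

section Evaluation

variable {ι : Type*} {E : Type*} [NormedAddCommGroup E] [InnerProductSpace ℂ E]
  {J : Type*} [NormedAddCommGroup J] [InnerProductSpace ℂ J]

/-- Point evaluations are bounded functionals on the Hardy space. -/
theorem exists_inner_eval_eq [CompleteSpace E] {Z : ι → E →L[ℂ] E}
    (hZ : IsStrictRowContraction Z) (x y : E) (g : J) :
    ∃ φ : H2 ι J →L[ℂ] ℂ, ∀ f, φ f = ⟪y, eval (fun α => ⟪g, f α⟫_ℂ) Z x⟫_ℂ := by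
  obtain ⟨r, hr0, hr1, hr⟩ := id hZ
  -- These are the conjugated coefficients of the functional: a Szegő-type kernel vector.
  have hk : Memℓp (fun α : FreeMonoid ι => ⟪mon Z α x, y⟫_ℂ) 2 := by
    refine memℓp_two_of_sum_le (C := ‖x‖ ^ 2 * ((1 - r ^ 2)⁻¹ * ‖y‖ ^ 2)) fun s => ?_
    calc ∑ α ∈ s, ‖⟪mon Z α x, y⟫_ℂ‖ ^ 2
        ≤ ∑ α ∈ s, ‖x‖ ^ 2 * ‖ContinuousLinearMap.adjoint (mon Z α) y‖ ^ 2 := by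
          refine Finset.sum_le_sum fun α _ => ?_
          rw [← ContinuousLinearMap.adjoint_inner_right, ← mul_pow]
          gcongr
          exact norm_inner_le_norm _ _
      _ ≤ _ := by
          rw [← Finset.mul_sum]
          gcongr
          -- The bound does not depend on the length cutoff, so any cutoff above the lengths in `s`
          -- serves.
          exact sum_norm_adjoint_mon_le hr0 hr1 hr (s.sup FreeMonoid.length + 1) s
            (fun α hα => Nat.lt_succ_of_le (Finset.le_sup (f := FreeMonoid.length) hα)) y
  let k : H2 ι ℂ := ⟨_, hk⟩
  let A : H2 ι J →L[ℂ] H2 ι ℂ :=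
    lp.mapCLM 2 (fun _ => innerSL ℂ g) (norm_nonneg (innerSL ℂ g)) (fun _ => le_rfl)
  refine ⟨innerSL ℂ k ∘L A, fun f => ?_⟩
  have h1 := lp.hasSum_inner (𝕜 := ℂ) k (A f)
  have h2 := (((summable_eval (A f) hZ).hasSum.mapL
    (ContinuousLinearMap.apply ℂ E x)).mapL (innerSL ℂ y))
  refine h1.unique ?_
  convert! h2 using 1
  ext α
  change A f α * (starRingEnd ℂ) ⟪mon Z α x, y⟫_ℂ = ⟪y, A f α • mon Z α x⟫_ℂ
  rw [inner_smul_right, inner_conj_symm]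

theorem inner_eval_monomial (Z : ι → E →L[ℂ] E) (x y : E) (g h : J) (β : FreeMonoid ι) :
    ⟪y, eval (fun α => ⟪g, monomial β h α⟫_ℂ) Z x⟫_ℂ = ⟪g, h⟫_ℂ * ⟪y, mon Z β x⟫_ℂ := by
  rw [eval, tsum_eq_single β fun α hα => by
    rw [monomial_apply_of_ne hα, inner_zero_right, zero_smul], monomial_apply_self, smul_apply,
    inner_smul_right]

theorem inner_eval_rightMul [CompleteSpace E] [CompleteSpace J] {Z : ι → E →L[ℂ] E}
    (hZ : IsStrictRowContraction Z) (x y : E) (g : J) (β : FreeMonoid ι) (f : H2 ι J) :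
    ⟪y, eval (fun α => ⟪g, rightMul β f α⟫_ℂ) Z x⟫_ℂ =
      ⟪y, eval (fun α => ⟪g, f α⟫_ℂ) Z (mon Z β x)⟫_ℂ := by
  obtain ⟨φ, hφ⟩ := exists_inner_eval_eq hZ x y g
  obtain ⟨ψ, hψ⟩ := exists_inner_eval_eq hZ (mon Z β x) y g
  have : φ ∘L (rightMul β).toContinuousLinearMap = ψ := ext_monomial fun α h => by
    have hmul : mon Z (α * β) x = mon Z α (mon Z β x) := by
      simp only [mon, map_mul]; rfl
    simp [rightMul_monomial, hφ, hψ, inner_eval_monomial, hmul]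
  rw [← hφ, ← hψ, ← this]
  rfl

end Evaluation

/-! ### Singularity locus and singularity space -/

namespace LeftMultiplier

variable {ι : Type*} {H J : Type*} [NormedAddCommGroup H] [InnerProductSpace ℂ H]
  [NormedAddCommGroup J] [InnerProductSpace ℂ J]

/-- The singularity space as a linear subspace. -/
def singSubmodule (M : LeftMultiplier ι H J) : Submodule ℂ (H2 ι J) where
  carrier := M.singSpace
  zero_mem' p hp x g := by
    obtain ⟨φ, hφ⟩ := exists_inner_eval_eq hp.2.1 x p.2.2 g
    rw [← hφ, map_zero]
  add_mem' {a b} ha hb p hp x g := by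
    obtain ⟨φ, hφ⟩ := exists_inner_eval_eq hp.2.1 x p.2.2 g
    rw [← hφ, map_add, hφ, hφ, ha p hp x g, hb p hp x g, add_zero]
  smul_mem' c a ha p hp x g := by
    obtain ⟨φ, hφ⟩ := exists_inner_eval_eq hp.2.1 x p.2.2 g
    rw [← hφ, map_smul, hφ, ha p hp x g, smul_zero]

theorem isClosed_singSpace (M : LeftMultiplier ι H J) : IsClosed M.singSpace := by
  have : M.singSpace = ⋂ p ∈ M.sing, ⋂ (x : Cn p.1) (g : J),
      {f : H2 ι J | ⟪p.2.2, eval (fun α => ⟪g, f α⟫_ℂ) p.2.1 x⟫_ℂ = 0} := by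
    ext f
    simp only [singSpace, Set.mem_iInter, Set.mem_ofPred_eq]
  rw [this]
  refine isClosed_biInter fun p hp => isClosed_iInter fun x => isClosed_iInter fun g => ?_
  obtain ⟨φ, hφ⟩ := exists_inner_eval_eq hp.2.1 x p.2.2 g
  simp only [← hφ]
  exact isClosed_singleton.preimage φ.continuous

variable [CompleteSpace J]

theorem rightMul_mem_singSpace (M : LeftMultiplier ι H J) (β : FreeMonoid ι) {f : H2 ι J}
    (hf : f ∈ M.singSpace) : rightMul β f ∈ M.singSpace := by
  intro p hp x g
  rw [inner_eval_rightMul hp.2.1]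
  exact hf p hp _ g

/-- On h 𝔷^β the value at Z is M(Z)h followed on the right by Z^β, which y^* kills. Boundedness
extends this from monomials to all f. -/
theorem op_mem_singSpace (M : LeftMultiplier ι H J) (f : H2 ι H) : M.op f ∈ M.singSpace := by
  intro p hp x g
  obtain ⟨φ, hφ⟩ := exists_inner_eval_eq hp.2.1 x p.2.2 g
  have : φ ∘L M.op = 0 := ext_monomial fun β h => by
    change φ (M.op (monomial β h)) = 0
    rw [hφ, op_monomial, inner_eval_rightMul hp.2.1]
    simp only [op_monomial_one]
    exact hp.2.2 _ h g
  rw [← hφ]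
  exact DFunLike.congr_fun this f

/-- If the range of `B` is the singularity space of `M`, then `B` and `M` have the same
singularity locus. -/
theorem sing_eq_of_range_eq {H' : Type*} [NormedAddCommGroup H'] [InnerProductSpace ℂ H']
    (M : LeftMultiplier ι H J) (B : LeftMultiplier ι H' J) (h : Set.range B.op = M.singSpace) :
    M.sing = B.sing := by
  refine Set.Subset.antisymm (fun p hp => ⟨hp.1, hp.2.1, fun x a g => ?_⟩)
    fun p hp => ⟨hp.1, hp.2.1, fun x a g => ?_⟩
  -- The symbol of B applied to a is the coefficient sequence of B(L)a, so testing constants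
  -- suffices.
  · have : B.op (monomial 1 a) ∈ M.singSpace := h ▸ Set.mem_range_self _
    simpa only [op_monomial_one] using this p hp x g
  · obtain ⟨f, hf⟩ : M.op (monomial 1 a) ∈ Set.range B.op := h ▸ M.op_mem_singSpace _
    have := B.op_mem_singSpace f
    rw [hf] at this
    simpa only [op_monomial_one] using this p hp x g

end LeftMultiplier

/-! ### Entries of rows and columns -/

section Entries

variable {ι : Type*} {N : ℕ∞}

/-- The power series `f ⊗ e_k`. -/
def tensorBasis (k : Idx N) : H2 ι ℂ →L[ℂ] H2 ι (Cn N) :=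
  lp.mapCLM 2 (fun _ => lp.singleContinuousLinearMap ℂ (fun _ : Idx N => ℂ) 2 k)
    (norm_nonneg (lp.singleContinuousLinearMap ℂ (fun _ : Idx N => ℂ) 2 k)) (fun _ => le_rfl)

theorem tensorBasis_apply (k : Idx N) (f : H2 ι ℂ) (α : FreeMonoid ι) :
    tensorBasis k f α = lp.single (E := fun _ : Idx N => ℂ) 2 k (f α) :=
  rfl

theorem inner_tensorBasis (k : Idx N) (f : H2 ι ℂ) (F : H2 ι (Cn N)) :
    ⟪tensorBasis k f, F⟫_ℂ = ∑' α, ⟪f α, F α k⟫_ℂ := by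
  rw [lp.inner_eq_tsum]
  exact tsum_congr fun α => lp.inner_single_left (G := fun _ : Idx N => ℂ) k (f α) (F α)

theorem inner_tensorBasis_self (k : Idx N) (f g : H2 ι ℂ) :
    ⟪tensorBasis k f, tensorBasis k g⟫_ℂ = ⟪f, g⟫_ℂ := by
  rw [inner_tensorBasis, lp.inner_eq_tsum]
  exact tsum_congr fun α => by rw [tensorBasis_apply, lp.single_apply_self]

theorem inner_tensorBasis_of_ne {j k : Idx N} (hjk : j ≠ k) (f g : H2 ι ℂ) :
    ⟪tensorBasis j f, tensorBasis k g⟫_ℂ = 0 := by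
  rw [inner_tensorBasis]
  refine (tsum_congr fun α => ?_).trans tsum_zero
  rw [tensorBasis_apply, lp.single_apply_ne _ _ _ hjk, inner_zero_right]

theorem norm_tensorBasis (k : Idx N) (f : H2 ι ℂ) : ‖tensorBasis k f‖ = ‖f‖ := by
  rw [← sq_eq_sq₀ (norm_nonneg _) (norm_nonneg _), ← inner_self_eq_norm_sq (𝕜 := ℂ),
    ← inner_self_eq_norm_sq (𝕜 := ℂ), inner_tensorBasis_self]

/-- The `k`-th component of a power series with coefficients in `ℂ ^ N`. -/
def component (k : Idx N) : H2 ι (Cn N) →L[ℂ] H2 ι ℂ :=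
  lp.mapCLM 2 (fun _ => lp.evalCLM ℂ (fun _ : Idx N => ℂ) 2 k)
    (norm_nonneg (lp.evalCLM ℂ (fun _ : Idx N => ℂ) 2 k)) (fun _ => le_rfl)

theorem hasSum_tensorBasis_component (F : H2 ι (Cn N)) :
    HasSum (fun k => tensorBasis k (component k F)) F := by
  -- ‖F‖² is a double sum over words and coordinates; exchanging the order gives ∑ ‖F_k‖² < ∞.
  have hsum : Summable fun p : FreeMonoid ι × Idx N => ‖F p.1 p.2‖ ^ 2 := by
    rw [summable_prod_of_nonneg fun _ => by positivity]
    refine ⟨fun α => (hasSum_norm_sq (F α)).summable, ?_⟩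
    simp only [(hasSum_norm_sq (F _)).tsum_eq]
    exact (hasSum_norm_sq F).summable
  have hsq : Summable fun k => ‖component k F‖ ^ 2 := by
    have := ((summable_prod_of_nonneg fun _ => by positivity).1 hsum.prod_symm).2
    refine this.congr fun k => ?_
    rw [← (hasSum_norm_sq (component k F)).tsum_eq]
    rfl
  have hV : OrthogonalFamily ℂ (fun _ : Idx N => H2 ι ℂ) fun k =>
      (⟨(tensorBasis k).toLinearMap, norm_tensorBasis k⟩ : H2 ι ℂ →ₗᵢ[ℂ] H2 ι (Cn N)) :=
    fun j k hjk f g => inner_tensorBasis_of_ne hjk f g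
  have hG := ((hV.summable_iff_norm_sq_summable _).2 hsq).hasSum
  -- The orthogonal series converges; its limit is identified one coefficient at a time.
  convert! hG using 1
  ext1
  funext α
  exact (lp.hasSum_single (E := fun _ : Idx N => ℂ) (by norm_num) (F α)).unique
    (hG.mapL (lp.evalCLM ℂ (fun _ : FreeMonoid ι => Cn N) 2 α))

namespace LeftMultiplier

theorem rowEntry_op (B : LeftMultiplier ι (Cn N) ℂ) (k : Idx N) (f : H2 ι ℂ) :
    (B.rowEntry k).op f = B.op (tensorBasis k f) :=
  rfl

theorem IsInner.inner_map_map {H J : Type*} [NormedAddCommGroup H] [InnerProductSpace ℂ H]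
    [NormedAddCommGroup J] [InnerProductSpace ℂ J] {M : LeftMultiplier ι H J} (hM : M.IsInner)
    (f g : H2 ι H) : ⟪M.op f, M.op g⟫_ℂ = ⟪f, g⟫_ℂ :=
  LinearIsometry.inner_map_map
    ⟨M.op.toLinearMap, fun f => hM.norm_map_of_map_zero (map_zero M.op) f⟩ f g

theorem IsInner.rowEntry {B : LeftMultiplier ι (Cn N) ℂ} (hB : B.IsInner) (k : Idx N) :
    (B.rowEntry k).IsInner :=
  AddMonoidHomClass.isometry_of_norm _ fun f => by
    rw [rowEntry_op, hB.norm_map_of_map_zero (map_zero B.op), norm_tensorBasis]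

theorem IsInner.inner_rowEntry_of_ne {B : LeftMultiplier ι (Cn N) ℂ} (hB : B.IsInner)
    {j k : Idx N} (hjk : j ≠ k) (f g : H2 ι ℂ) :
    ⟪(B.rowEntry j).op f, (B.rowEntry k).op g⟫_ℂ = 0 := by
  rw [rowEntry_op, rowEntry_op, hB.inner_map_map, inner_tensorBasis_of_ne hjk]

theorem hasSum_rowEntry_colEntry (B : LeftMultiplier ι (Cn N) ℂ) (S : LeftMultiplier ι ℂ (Cn N))
    (f : H2 ι ℂ) :
    HasSum (fun k => (B.rowEntry k).op ((S.colEntry k).op f)) (B.op (S.op f)) :=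
  (hasSum_tensorBasis_component (S.op f)).mapL B.op

end LeftMultiplier

end Entries

theorem exists_equiv_Idx (κ : Type*) [Countable κ] : ∃ N : ℕ∞, Nonempty (κ ≃ Idx N) := by
  rcases finite_or_infinite κ with h | h
  · refine ⟨Nat.card κ, ⟨(Finite.equivFin κ).trans (Fin.equivSubtype.trans ?_)⟩⟩
    exact Equiv.subtypeEquivRight fun k => by simp
  · obtain ⟨e⟩ := nonempty_equiv_of_countable (α := κ) (β := ℕ)
    exact ⟨⊤, ⟨e.trans (Equiv.subtypeUnivEquiv fun k => ENat.natCast_lt_top k).symm⟩⟩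

/-! ### Wold decomposition and Beurling's theorem -/

section Beurling

variable {ι : Type*} {H : Type*} [NormedAddCommGroup H] [InnerProductSpace ℂ H]

/-- By Bessel, each of the countably many monomials pairs nontrivially with only countably many v_s,
and every v_s has a nonzero coefficient. -/
theorem countable_of_orthonormal [Countable ι] {κ : Type*} {v : κ → H2 ι ℂ}
    (hv : Orthonormal ℂ v) : Countable κ := by
  have : Countable (FreeMonoid ι) := inferInstanceAs (Countable (List ι))
  have hα : ∀ α : FreeMonoid ι, {s | v s α ≠ 0}.Countable := fun α => by
    refine (hv.inner_products_summable (monomial α (1 : ℂ))).countable_support.mono fun s hs => ?_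
    have : ⟪v s, monomial α (1 : ℂ)⟫_ℂ ≠ 0 := by
      rw [← inner_conj_symm, inner_monomial_left]
      simpa using hs
    simpa using this
  refine Set.countable_univ_iff.1 ((Set.countable_iUnion hα).mono fun s _ => ?_)
  by_contra h
  simp only [Set.mem_iUnion, Set.mem_ofPred_eq, not_exists, not_not] at h
  refine hv.ne_zero s ?_
  ext α
  exact h α

/-- A closed subspace of the Hardy space is isometric to some `ℂ ^ N`. -/
theorem exists_linearIsometryEquiv_Cn [Countable ι] (W : Submodule ℂ (H2 ι ℂ)) [CompleteSpace W] :
    ∃ N : ℕ∞, Nonempty (Cn N ≃ₗᵢ[ℂ] W) := by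
  obtain ⟨w, b, -⟩ := exists_hilbertBasis ℂ W
  have hb : Orthonormal ℂ fun s => (b s : H2 ι ℂ) := b.orthonormal.comp_linearIsometry W.subtypeₗᵢ
  have := countable_of_orthonormal hb
  obtain ⟨N, ⟨e⟩⟩ := exists_equiv_Idx w
  have hbe : Orthonormal ℂ (b ∘ e.symm) := b.orthonormal.comp _ e.symm.injective
  refine ⟨N, ⟨(HilbertBasis.mk hbe ?_).repr.symm⟩⟩
  rw [e.symm.surjective.range_comp, b.dense_span]

variable [CompleteSpace H]

/-- The closed span of the products `f 𝔷 j` for `f` in `K`. -/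
def shiftSpan (K : Submodule ℂ (H2 ι H)) : Submodule ℂ (H2 ι H) :=
  (Submodule.span ℂ {g | ∃ j, ∃ f ∈ K, g = rightMul (.of j) f}).topologicalClosure

variable {K : Submodule ℂ (H2 ι H)}

theorem rightMul_mem_shiftSpan (j : ι) {f : H2 ι H} (hf : f ∈ K) :
    rightMul (.of j) f ∈ shiftSpan K :=
  Submodule.le_topologicalClosure _ (Submodule.subset_span ⟨j, f, hf, rfl⟩)

theorem shiftSpan_induction {F : Type*} [NormedAddCommGroup F] [NormedSpace ℂ F]
    (A : H2 ι H →L[ℂ] F) {L : Submodule ℂ F} (hL : IsClosed (L : Set F))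
    (h : ∀ j, ∀ f ∈ K, A (rightMul (.of j) f) ∈ L) {f : H2 ι H} (hf : f ∈ shiftSpan K) :
    A f ∈ L := by
  have hle : shiftSpan K ≤ L.comap A.toLinearMap := by
    refine Submodule.topologicalClosure_minimal _ (Submodule.span_le.2 ?_)
      (hL.preimage A.continuous)
    rintro _ ⟨j, f, hf, rfl⟩
    exact h j f hf
  exact hle hf

theorem apply_one_of_mem_shiftSpan {f : H2 ι H} (hf : f ∈ shiftSpan K) : f 1 = 0 := by
  have := shiftSpan_induction (lp.evalCLM ℂ (fun _ : FreeMonoid ι => H) 2 1) (L := ⊥)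
    isClosed_singleton (fun j g _ => ?_) hf
  · exact this
  · refine rightMul_apply_of_notMem ?_ g
    rintro ⟨β, hβ⟩
    simpa using congrArg FreeMonoid.length hβ

/-- On generators, R_j^* R_i f is f or 0, since the shifts are isometries with orthogonal ranges. -/
theorem adjoint_rightMul_mem_of_mem_shiftSpan (hK : IsClosed (K : Set (H2 ι H))) (j : ι)
    {f : H2 ι H} (hf : f ∈ shiftSpan K) :
    ContinuousLinearMap.adjoint (rightMul (.of j)).toContinuousLinearMap f ∈ K := by
  refine shiftSpan_induction _ hK (fun i g hg => ?_) hf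
  by_cases hij : i = j
  · subst hij
    convert! hg using 1
    refine ext_inner_left ℂ fun h => ?_
    rw [ContinuousLinearMap.adjoint_inner_right, LinearIsometry.coe_toContinuousLinearMap,
      LinearIsometry.inner_map_map]
  · convert! K.zero_mem using 1
    refine ext_inner_left ℂ fun h => ?_
    rw [ContinuousLinearMap.adjoint_inner_right, LinearIsometry.coe_toContinuousLinearMap,
      inner_rightMul_of_ne (Ne.symm hij), inner_zero_right]

theorem rightMul_mem (hK : ∀ j, ∀ f ∈ K, rightMul (.of j) f ∈ K) (α : FreeMonoid ι)
    {f : H2 ι H} (hf : f ∈ K) : rightMul α f ∈ K := by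
  induction α using reverseInduction with
  | one => rwa [rightMul_one]
  | mul_of α i ih => rw [← rightMul_rightMul]; exact hK i _ ih

theorem shiftSpan_le (hK : ∀ j, ∀ f ∈ K, rightMul (.of j) f ∈ K)
    (hKc : IsClosed (K : Set (H2 ι H))) : shiftSpan K ≤ K :=
  fun _ hf => shiftSpan_induction (.id ℂ _) hKc hK hf

/-- The wandering subspace of `K`. -/
def wandering (K : Submodule ℂ (H2 ι H)) : Submodule ℂ (H2 ι H) :=
  K ⊓ (shiftSpan K)ᗮ

/-- Strip common last letters. Either the last letters come to differ and the ranges are orthogonal,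
or one word runs out, leaving a wandering vector against an element of `shiftSpan K`. -/
theorem inner_rightMul_wandering (hK : ∀ j, ∀ f ∈ K, rightMul (.of j) f ∈ K)
    {f g : H2 ι H} (hf : f ∈ wandering K) (hg : g ∈ wandering K) {α β : FreeMonoid ι}
    (hne : α ≠ β) : ⟪rightMul α f, rightMul β g⟫_ℂ = 0 := by
  induction α using reverseInduction generalizing β with
  | one =>
    induction β using reverseInduction with
    | one => exact absurd rfl hne
    | mul_of β j _ =>
      rw [rightMul_one, ← rightMul_rightMul]
      exact Submodule.inner_left_of_mem_orthogonal
        (rightMul_mem_shiftSpan j (rightMul_mem hK β hg.1)) hf.2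
  | mul_of α i ih =>
    induction β using reverseInduction with
    | one =>
      rw [rightMul_one, ← rightMul_rightMul]
      exact Submodule.inner_right_of_mem_orthogonal
        (rightMul_mem_shiftSpan i (rightMul_mem hK α hf.1)) hg.2
    | mul_of β j _ =>
      rw [← rightMul_rightMul, ← rightMul_rightMul]
      by_cases hij : i = j
      · subst hij
        rw [LinearIsometry.inner_map_map]
        exact ih fun h => hne (h ▸ rfl)
      · exact inner_rightMul_of_ne hij _ _

/-- Wold decomposition: there is nothing in `K` orthogonal to all shifts of its wandering
subspace. -/
theorem eq_zero_of_inner_rightMul_wandering (hKc : IsClosed (K : Set (H2 ι H)))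
    (hK : ∀ j, ∀ f ∈ K, rightMul (.of j) f ∈ K) {f : H2 ι H} (hf : f ∈ K)
    (h : ∀ α, ∀ w ∈ wandering K, ⟪rightMul α w, f⟫_ℂ = 0) : f = 0 := by
  -- The case α = 1 says that f has no wandering component.
  have hS : ∀ f ∈ K, (∀ α, ∀ w ∈ wandering K, ⟪rightMul α w, f⟫_ℂ = 0) → f ∈ shiftSpan K := by
    intro f hf h
    have : CompleteSpace (shiftSpan K) :=
      (Submodule.isClosed_topologicalClosure _).completeSpace_coe
    obtain ⟨a, ha, b, hb, rfl⟩ := (shiftSpan K).exists_add_mem_mem_orthogonal f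
    have hbK : b ∈ K := by
      simpa using K.sub_mem hf (shiftSpan_le hK hKc ha)
    have h0 := h 1 b ⟨hbK, hb⟩
    rw [rightMul_one, inner_add_right, Submodule.inner_left_of_mem_orthogonal ha hb, zero_add,
      inner_self_eq_zero] at h0
    rwa [h0, add_zero]
  -- R_i^* preserves both hypotheses and shifts coefficients, so everything reduces to the constant
  -- coefficient, which vanishes on `shiftSpan K`.
  ext α
  change f α = 0
  induction α using reverseInduction generalizing f with
  | one => exact apply_one_of_mem_shiftSpan (hS f hf h)
  | mul_of α i ih =>
    rw [← adjoint_rightMul_apply]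
    refine ih (adjoint_rightMul_mem_of_mem_shiftSpan hKc i (hS f hf h)) fun β w hw => ?_
    rw [ContinuousLinearMap.adjoint_inner_right, LinearIsometry.coe_toContinuousLinearMap,
      rightMul_rightMul]
    exact h _ w hw

/-- Beurling's theorem: a closed right-invariant subspace is the range of an inner row. -/
theorem exists_isInner_range_eq [Countable ι] {K : Submodule ℂ (H2 ι ℂ)}
    (hKc : IsClosed (K : Set (H2 ι ℂ))) (hK : ∀ j, ∀ f ∈ K, rightMul (.of j) f ∈ K) :
    ∃ (N : ℕ∞) (B : LeftMultiplier ι (Cn N) ℂ), B.IsInner ∧ Set.range B.op = K := by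
  have hW : IsClosed (wandering K : Set (H2 ι ℂ)) :=
    hKc.inter (shiftSpan K).isClosed_orthogonal
  have : CompleteSpace (wandering K) := hW.completeSpace_coe
  obtain ⟨N, ⟨e⟩⟩ := exists_linearIsometryEquiv_Cn (wandering K)
  -- The orthogonal copies of the wandering subspace, one per word, assemble into the isometry x 𝔷^α
  -- ↦ e(x) 𝔷^α.
  let V : FreeMonoid ι → Cn N →ₗᵢ[ℂ] H2 ι ℂ := fun α =>
    (rightMul α).comp ((wandering K).subtypeₗᵢ.comp e.toLinearIsometry)
  have hV : OrthogonalFamily ℂ (fun _ : FreeMonoid ι => Cn N) V := fun α β hne x y =>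
    inner_rightMul_wandering hK (e x).2 (e y).2 hne
  have hmon : ∀ α x, hV.linearIsometry (monomial α x) = rightMul α (e x : H2 ι ℂ) := fun α x => by
    let := Classical.decEq (FreeMonoid ι)
    exact hV.linearIsometry_apply_single x
  let B := LeftMultiplier.ofCommute hV.linearIsometry.toContinuousLinearMap fun β h => by
    simp [hmon, rightMul_one]
  have hBop : ∀ f, B.op f = hV.linearIsometry f := fun _ => rfl
  have hBK : ∀ F, B.op F ∈ K := fun F =>
    hKc.mem_of_tendsto (hV.hasSum_linearIsometry F) <| .of_forall fun s =>
      K.sum_mem fun α _ => rightMul_mem hK α (e (F α)).2.1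
  refine ⟨N, B, hV.linearIsometry.isometry, Set.Subset.antisymm ?_ fun f hf => ?_⟩
  · rintro _ ⟨F, rfl⟩
    exact hBK F
  -- f - BB^*f lies in K and is orthogonal to all shifts of the wandering subspace, hence is zero.
  · refine ⟨ContinuousLinearMap.adjoint B.op f, (sub_eq_zero.1 ?_).symm⟩
    refine eq_zero_of_inner_rightMul_wandering hKc hK (K.sub_mem hf (hBK _)) fun α w hw => ?_
    have hw' : rightMul α w = B.op (monomial α (e.symm ⟨w, hw⟩)) := by
      rw [hBop, hmon, LinearIsometryEquiv.apply_symm_apply]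
    rw [hw', inner_sub_right, hBop (ContinuousLinearMap.adjoint B.op f), hBop,
      LinearIsometry.inner_map_map, ContinuousLinearMap.adjoint_inner_right, hBop, sub_self]

end Beurling

/-! ### Factorization through an inner multiplier -/

namespace LeftMultiplier

variable {ι : Type*} {H H' J : Type*} [NormedAddCommGroup H] [InnerProductSpace ℂ H]
  [NormedAddCommGroup H'] [InnerProductSpace ℂ H'] [CompleteSpace H']
  [NormedAddCommGroup J] [InnerProductSpace ℂ J] [CompleteSpace J]

/-- An isometric multiplier factors through any inner multiplier with larger range. -/
theorem IsInner.exists_eq_comp {M : LeftMultiplier ι H J} {B : LeftMultiplier ι H' J}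
    (hM : M.IsInner) (hB : B.IsInner) (h : Set.range M.op ⊆ Set.range B.op) :
    ∃ S : LeftMultiplier ι H H', M.op = B.op ∘L S.op ∧ S.IsInner := by
  -- BB^* is the identity on ran B, which contains ran M, so BT = M.
  let T := ContinuousLinearMap.adjoint B.op ∘L M.op
  have hT : ∀ f, B.op (T f) = M.op f := fun f => by
    obtain ⟨F, hF⟩ := h (Set.mem_range_self f)
    have : ContinuousLinearMap.adjoint B.op (B.op F) = F := ext_inner_left ℂ fun G => by
      rw [ContinuousLinearMap.adjoint_inner_right, hB.inner_map_map]
    change B.op (ContinuousLinearMap.adjoint B.op (M.op f)) = _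
    rw [← hF, this]
  refine ⟨ofCommute T fun β a => hB.injective ?_, ContinuousLinearMap.ext fun f => (hT f).symm,
    AddMonoidHomClass.isometry_of_norm _ fun f => ?_⟩
  -- Commutation with right multiplication is checked after applying the injective B.
  · rw [op_rightMul, hT, hT, op_monomial]
  · change ‖T f‖ = ‖f‖
    rw [← hM.norm_map_of_map_zero (map_zero M.op) f, ← hT,
      hB.norm_map_of_map_zero (map_zero B.op)]

end LeftMultiplier

end NCHardy

end

theorem mainTheorem8 {ι : Type*} [Countable ι] (Θ : NCHardy.LeftMultiplier ι ℂ ℂ)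
    (hΘ : Θ.IsInner) :
    ∃ (N : ℕ∞) (B : NCHardy.LeftMultiplier ι (NCHardy.Cn N) ℂ)
      (S : NCHardy.LeftMultiplier ι ℂ (NCHardy.Cn N)),
      Θ.op = B.op ∘L S.op ∧
      (∀ f : NCHardy.H2 ι ℂ,
        HasSum (fun k => (B.rowEntry k).op ((S.colEntry k).op f)) (Θ.op f)) ∧
      Set.range B.op = Θ.singSpace ∧
      Θ.sing = B.sing ∧
      B.IsBlaschke ∧
      (∀ k, (B.rowEntry k).IsInner) ∧
      (∀ j k, j ≠ k → ∀ f g : NCHardy.H2 ι ℂ,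
        ⟪(B.rowEntry j).op f, (B.rowEntry k).op g⟫_ℂ = 0) ∧
      S.IsInner := by
  obtain ⟨N, B, hB, hBr⟩ := NCHardy.exists_isInner_range_eq (K := Θ.singSubmodule)
    Θ.isClosed_singSpace fun j f hf => Θ.rightMul_mem_singSpace (.of j) hf
  have hBr' : Set.range B.op = Θ.singSpace := hBr
  obtain ⟨S, hS, hSi⟩ := hΘ.exists_eq_comp hB <| by
    rintro _ ⟨f, rfl⟩
    exact hBr' ▸ Θ.op_mem_singSpace f
  have hsing := Θ.sing_eq_of_range_eq B hBr'
  refine ⟨N, B, S, hS, fun f => ?_, hBr', hsing, ⟨hB, ?_⟩, hB.rowEntry,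
    fun j k hjk => hB.inner_rowEntry_of_ne hjk, hSi⟩
  · rw [hS]
    exact B.hasSum_rowEntry_colEntry S f
  -- The singularity space depends only on the singularity locus.
  · rw [hBr', NCHardy.LeftMultiplier.singSpace, NCHardy.LeftMultiplier.singSpace, hsing]
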